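/- **Setting.** Let $\mathcal K$ be a Fraïssé class of finite structures over a finite relational signature, $\mathfrak U$ its Fraïssé limit (the countable homogeneous structure whose finite substructures are, up to isomorphism, exactly the members of $\mathcal K$), $\mathbb D_{\mathcal K}$ the carrier of $\mathfrak U$ and $G_{\mathcal K}=\mathrm{Aut}(\mathfrak U)$. A set $C\subseteq\mathbb D_{\mathcal K}$ *supports* an element $x$ of a $G_{\mathcal K}$-set if every $\pi\in G_{\mathcal K}$ that is the identity on $C$ fixes $x$; a $G_{\mathcal K}$-set is *nominal* if each of its elements has a finite support, and *orbit finite* if it has finitely many orbits. Assume that the symmetry $(\mathbb D_{\mathcal K},G_{\mathcal K})$ is *well-behaved*: every element of every nominal $G_{\mathcal K}$-set has a least finite support, and for every finite $C\subseteq\mathbb D_{\mathcal K}$ and $c\in C$ some $\pi\in G_{\mathcal K}$ moves $c$ and fixes all other elements of $C$. A *deterministic $G_{\mathcal K}$-automaton* over the alphabet $\mathbb D_{\mathcal K}$ has a $G_{\mathcal K}$-set of states, a $G_{\mathcal K}$-fixed initial state, an equivariant set of accepting states and an equivariant transition function. It is a *$G_{\mathcal K}$-DFA* if it is orbit finite and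 nominal (both its alphabet and its set of states are orbit finite nominal sets). Isomorphisms of automata are equivariant bijections that preserve the initial state, acceptance (in both directions) and the transition function. An *annotation* of $\mathfrak A\in\mathcal K$ is either a structure $\mathfrak A^*\in\mathcal K$ on $A\cup\{*\}$, with $*\notin A$, that has $\mathfrak A$ as an induced substructure, or $\mathfrak A^*=\mathfrak A$ with a distinguished element $*\in A$. For $S\le\mathrm{Aut}(\mathfrak A)$, an *$S$-isomorphism* between annotations of $\mathfrak A$ is an isomorphism that maps $*$ to $*$ and restricts on $A$ to an element of $S$. A *Fraïssé $\mathcal K$-automaton* consists of - a finite set $Q$ of control states, an initial state $q_I\in Q$ and a set $F\subseteq Q$ of accepting states; - for each $q\in Q$, a register structure $\mathfrak A_q\in\mathcal K$ and a local symmetry $S_q\le\mathrm{Aut}(\mathfrak A_q)$, where $\mathfrak A_{q_I}$ is empty; - a symbolic transition function, which maps each $q\in Q$ and each annotation $\mathfrak A^*$ of $\mathfrak A_q$ to a state $p\in Q$ with an embedding $s_q(\mathfrak A^*):\mathfrak A_p\to\mathfrak A^*$, such that for every $S_q$-isomorphism $f:\mathfrak A^*\to\mathfrak A^{*\prime}$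 the annotations $\mathfrak A^*$ and $\mathfrak A^{*\prime}$ are mapped to the same state $p$, and $f\circ s_q(\mathfrak A^*)= s_q(\mathfrak A^{*\prime})\circ\tau$ for some $\tau\in S_p$. It induces the following deterministic $G_{\mathcal K}$-automaton over $\mathbb D_{\mathcal K}$. States are pairs $(q,[\eta])$, where $\eta:\mathfrak A_q\to\mathfrak U$ is an embedding taken up to precomposition with elements of $S_q$, and $G_{\mathcal K}$ acts by composition; the initial state is $q_I$ with the empty embedding; a state is accepting if $q\in F$. On input $d$ in state $(q,[\eta])$, let $\mathfrak A^*$ be the annotation for which the extension $\eta^*$ of $\eta$ by $*\mapsto d$ is an embedding $\mathfrak A^*\to\mathfrak U$; if $s_q(\mathfrak A^*)$ has target state $p$, the new state is $(p,[\eta^*\circ s_q(\mathfrak A^*)])$. **Theorem.** Every reachable orbit-finite deterministic nominal $G_{\mathcal K}$-automaton over the alphabet $\mathbb D_{\mathcal K}$ is isomorphic to (the automaton induced by) a Fraïssé $\mathcal K$-automaton. **Corollary.** For every $G_{\mathcal K}$-language (equivariant set of words) $L\subseteq\mathbb D_{\mathcal K}^*$ the following are equivalent: 1. $L$ is recognized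 by a $G_{\mathcal K}$-DFA; 2. $L$ is recognized by a Fraïssé $\mathcal K$-automaton; 3. the syntactic quotient $\mathbb D_{\mathcal K}^*/{\equiv_L}$ is orbit finite, where $w\equiv_L w'$ means that $wv\in L\iff w'v\in L$ for all $v\in\mathbb D_{\mathcal K}^*$. -/

import Mathlib

universe u v w x

namespace NominalAutomata

open FirstOrder FirstOrder.Language

open CategoryTheory (Bundled)

/-! ### Data symmetries and nominal sets

A data symmetry is a type `D` of data values with a subgroup `G` of its symmetric group.
Right actions, with composition read from left to right, are the same thing as left actions of
the group `G ≤ Equiv.Perm D`, in which composition is read from right to left; so a `G`-set is a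
type with an instance `MulAction G X`.  In particular `D` itself is a `G`-set, with
`π • d = π d`. -/

section Symmetry

variable {D : Type w} (G : Subgroup (Equiv.Perm D))

/-- `C` supports `a` if every group element that is the identity on `C` fixes `a`. -/
def Supports {X : Type x} [MulAction G X] (C : Set D) (a : X) : Prop :=
  ∀ π : G, (∀ c ∈ C, π • c = c) → π • a = a

/-- A `G`-set is nominal if each of its elements has a finite support. -/
def IsNominal (X : Type x) [MulAction G X] : Prop :=
  ∀ a : X, ∃ C : Set D, C.Finite ∧ Supports G C a

/-- A `G`-set is orbit finite if it has finitely many orbits. -/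
def OrbitFinite (X : Type x) [MulAction G X] : Prop :=
  Finite (MulAction.orbitRel.Quotient G X)

/-- Every element of every nominal `G`-set has a least finite support.  (Every single-orbit
`G`-set is isomorphic to a coset space of `G`, so `G`-sets in the universe of `D` suffice.) -/
def AdmitsLeastSupports : Prop :=
  ∀ (X : Type w) [MulAction G X], IsNominal G X →
    ∀ a : X, ∃ C : Set D, IsLeast {C' : Set D | C'.Finite ∧ Supports G C' a} C

/-- Every finite set `C` of data values is fungible: each `c ∈ C` can be moved while all other
elements of `C` are fixed. -/
def IsFungible : Prop :=
  ∀ C : Set D, C.Finite → ∀ c ∈ C, ∃ π : G, π • c ≠ c ∧ ∀ c' ∈ C, c' ≠ c → π • c' = c'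

/-- A well-behaved data symmetry. -/
structure WellBehaved : Prop where
  leastSupports : AdmitsLeastSupports G
  fungible : IsFungible G

end Symmetry

/-! ### Deterministic `G`-automata and `G`-languages -/

section Automata

variable {D : Type w} (G : Subgroup (Equiv.Perm D))

/-- A deterministic `G`-automaton with alphabet `A` and set of states `X`: a deterministic
automaton (with no finiteness assumption) all of whose components are equivariant. -/
structure DetAutomaton (A : Type w) [MulAction G A] (X : Type x) [MulAction G X]
    extends DFA A X where
  start_equivariant : ∀ π : G, π • start = start
  accept_equivariant : ∀ (π : G) (q : X), π • q ∈ accept ↔ q ∈ accept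
  step_equivariant : ∀ (π : G) (q : X) (a : A), step (π • q) (π • a) = π • step q a

/-- A `G`-language: an equivariant set of words. -/
structure GLanguage (A : Type w) [MulAction G A] where
  words : Set (List A)
  equivariant : ∀ (π : G) (l : List A), l.map (π • ·) ∈ words ↔ l ∈ words

variable {G}

namespace DetAutomaton

variable {A : Type w} [MulAction G A] {X : Type x} [MulAction G X]

/-- Every state is reached from the initial state by some word. -/
def Reachable (M : DetAutomaton G A X) : Prop :=
  ∀ q : X, ∃ l : List A, M.toDFA.eval l = q

/-- The automaton recognizes the language `L`. -/
def Recognizes (M : DetAutomaton G A X) (L : GLanguage G A) : Prop :=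
  ∀ l : List A, l ∈ M.toDFA.accepts ↔ l ∈ L.words

/-- The automaton is a `G`-DFA: a (deterministic) orbit finite nominal `G`-automaton.  Its
alphabet is an orbit finite nominal `G`-set, and so is its set of states. -/
structure IsGDFA (_M : DetAutomaton G A X) : Prop where
  alphabet_orbitFinite : OrbitFinite G A
  alphabet_nominal : IsNominal G A
  states_orbitFinite : OrbitFinite G X
  states_nominal : IsNominal G X

/-- An isomorphism of deterministic `G`-automata over the same alphabet. -/
structure Iso {Y : Type*} [MulAction G Y] (M : DetAutomaton G A X) (N : DetAutomaton G A Y)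
    extends X ≃ Y where
  map_smul : ∀ (π : G) (q : X), toFun (π • q) = π • toFun q
  map_start : toFun M.start = N.start
  map_accept : ∀ q : X, q ∈ M.accept ↔ toFun q ∈ N.accept
  map_step : ∀ (q : X) (a : A), toFun (M.step q a) = N.step (toFun q) a

end DetAutomaton

namespace GLanguage

variable {A : Type w} [MulAction G A] (L : GLanguage G A)

/-- The Myhill-Nerode equivalence of a language. -/
def syntacticSetoid : Setoid (List A) where
  r l l' := ∀ k : List A, l ++ k ∈ L.words ↔ l' ++ k ∈ L.words
  iseqv := ⟨fun _ _ => Iff.rfl, fun h k => (h k).symm, fun h h' k => (h k).trans (h' k)⟩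

/-- The syntactic quotient: all words modulo Myhill-Nerode equivalence. -/
def SyntacticQuotient : Type w := Quotient L.syntacticSetoid

theorem syntacticSetoid_smul (π : G) {l l' : List A} (h : L.syntacticSetoid l l') :
    L.syntacticSetoid (l.map (π • ·)) (l'.map (π • ·)) := by
  have key : ∀ m k : List A,
      m.map (π • ·) ++ k ∈ L.words ↔ m ++ k.map (π⁻¹ • ·) ∈ L.words := by
    intro m k
    rw [← L.equivariant π (m ++ k.map (π⁻¹ • ·))]
    simp [Function.comp_def]
  intro k
  rw [key, key]
  exact h _

/-- `G` acts on the syntactic quotient by `π • [l] = [π • l]`. -/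
instance : MulAction G L.SyntacticQuotient where
  smul π := Quotient.map (fun l => l.map (π • ·)) fun _ _ h => L.syntacticSetoid_smul π h
  one_smul := by
    rintro ⟨l⟩
    exact congrArg (Quotient.mk L.syntacticSetoid) (by simp)
  mul_smul := by
    rintro π ρ ⟨l⟩
    exact congrArg (Quotient.mk L.syntacticSetoid) (by simp [Function.comp_def, mul_smul])

end GLanguage

end Automata

/-! ### Automorphism groups and structure representations -/

section Structures

variable (L : FirstOrder.Language.{u, v})

/-- The automorphism group of a structure, as a group of permutations of its carrier. -/
def autGroup (M : Type w) [L.Structure M] : Subgroup (Equiv.Perm M) where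
  carrier := {π | ∃ g : M ≃[L] M, ∀ a, g a = π a}
  one_mem' := ⟨Language.Equiv.refl L M, fun _ => rfl⟩
  mul_mem' := by
    rintro π ρ ⟨g, hg⟩ ⟨h, hh⟩
    exact ⟨g.comp h, fun a => by simp [hg, hh]⟩
  inv_mem' := by
    rintro π ⟨g, hg⟩
    refine ⟨g.symm, fun a => ?_⟩
    apply g.injective
    rw [Language.Equiv.apply_symm_apply, hg]
    exact (Equiv.apply_symm_apply π a).symm

variable {L}

/-- An automorphism, regarded as an embedding. -/
def autEmb {M : Type w} [L.Structure M] (π : autGroup L M) : M ↪[L] M where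
  toFun := π.1
  inj' := π.1.injective
  map_fun' := by
    intro n f a
    obtain ⟨g, hg⟩ := π.2
    have h : (π.1 : M → M) = g := (funext hg).symm
    simp only [h]
    exact g.map_fun f a
  map_rel' := by
    intro n r a
    obtain ⟨g, hg⟩ := π.2
    have h : (π.1 : M → M) = g := (funext hg).symm
    simp only [h]
    exact g.map_rel r a

@[simp] theorem autEmb_apply {M : Type w} [L.Structure M] (π : autGroup L M) (a : M) :
    autEmb π a = π.1 a := rfl

/-- Two embeddings `p, q : A → B` are equivalent modulo a group `S` of automorphisms of `A` if
`q = p ∘ τ` for some `τ ∈ S`. -/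
def valuationSetoid {A : Type w} [L.Structure A] (S : Subgroup (autGroup L A))
    (B : Type w) [L.Structure B] : Setoid (A ↪[L] B) where
  r p q := ∃ τ ∈ S, p.comp (autEmb τ) = q
  iseqv := by
    refine ⟨fun p => ⟨1, S.one_mem, by ext; simp⟩, ?_, ?_⟩
    · rintro p _ ⟨τ, hτ, rfl⟩
      exact ⟨τ⁻¹, S.inv_mem hτ, by ext; simp⟩
    · rintro p _ _ ⟨τ, hτ, rfl⟩ ⟨σ, hσ, rfl⟩
      exact ⟨τ * σ, S.mul_mem hτ hσ, by ext; simp⟩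

/-- Embeddings of `A` into `B` modulo `S`.  When `B` is the universal structure, this is the
semantics of the structure representation `(A, S)`. -/
def RegValuation {A : Type w} [L.Structure A] (S : Subgroup (autGroup L A))
    (B : Type w) [L.Structure B] : Type w :=
  Quotient (valuationSetoid S B)

namespace RegValuation

variable {A : Type w} [L.Structure A] {S : Subgroup (autGroup L A)}
  {B : Type w} [L.Structure B]

/-- The class of an embedding. -/
def mk (S : Subgroup (autGroup L A)) (p : A ↪[L] B) : RegValuation S B :=
  Quotient.mk (valuationSetoid S B) p

/-- Automorphisms of `B` act on classes of embeddings by composition. -/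
instance : MulAction (autGroup L B) (RegValuation S B) where
  smul π := Quotient.map (fun p => (autEmb π).comp p) (by
    rintro p _ ⟨τ, hτ, rfl⟩
    exact ⟨τ, hτ, by ext; simp⟩)
  one_smul := by
    rintro ⟨p⟩
    exact congrArg (mk S) (by ext; simp)
  mul_smul := by
    rintro π ρ ⟨p⟩
    exact congrArg (mk S) (by ext; simp)

theorem smul_mk (π : autGroup L B) (p : A ↪[L] B) : π • mk S p = mk S ((autEmb π).comp p) := rfl

end RegValuation

/-! ### Annotations -/

/-- An annotation of a structure `A` (relative to the class `K`): either a structure in `K` on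
`A` extended by one new element `*` (here `none`), in which `A` is an induced substructure, or
`A` itself with a distinguished element `*`. -/
inductive Annotation (K : Set (Bundled.{w} L.Structure)) (A : Type w) [L.Structure A] where
  | extend (str : L.Structure (Option A))
      (conservative : ∀ (n : ℕ) (r : L.Relations n) (a : Fin n → A),
        str.RelMap r (fun i => some (a i)) ↔ Structure.RelMap r a)
      (mem : (⟨Option A, str⟩ : Bundled.{w} L.Structure) ∈ K)
  | distinguish (a : A)

namespace Annotation

variable {K : Set (Bundled.{w} L.Structure)} {A : Type w} [L.Structure A]

/-- The underlying structure of an annotation. -/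
def toStructure : Annotation K A → Bundled.{w} L.Structure
  | extend str _ _ => ⟨Option A, str⟩
  | distinguish _ => ⟨A, inferInstance⟩

/-- The element `*` of an annotation. -/
def star : (α : Annotation K A) → α.toStructure
  | extend _ _ _ => (none : Option A)
  | distinguish a => a

/-- The embedding of `A` into an annotation of `A`. -/
def incl [L.IsRelational] : (α : Annotation K A) → A ↪[L] α.toStructure
  | extend str cons _ =>
    letI := str
    { toFun := (some : A → Option A)
      inj' := Option.some_injective A
      map_fun' := fun {n} f _ => ((inferInstance : IsEmpty (L.Functions n)).false f).elim
      map_rel' := fun {n} r a => cons n r a }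
  | distinguish _ => Embedding.refl L A

/-- Isomorphisms of annotations of `A` modulo `S`: isomorphisms of the underlying structures that
map `*` to `*` and restrict to some `σ ∈ S` on `A`.  Two annotations are identified if they are
isomorphic in this sense; the automorphisms in this sense form the local symmetry of an
annotation. -/
structure Iso [L.IsRelational] (S : Subgroup (autGroup L A)) (α β : Annotation K A) where
  toEquiv : α.toStructure ≃[L] β.toStructure
  map_star : toEquiv α.star = β.star
  map_incl : ∃ σ ∈ S, ∀ a : A, toEquiv (α.incl a) = β.incl (σ.1 a)

theorem cover [L.IsRelational] (α : Annotation K A) (z : α.toStructure) :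
    z = α.star ∨ ∃ a, z = α.incl a := by
  cases α with
  | extend str c m =>
    rcases (z : Option A) with _ | a
    · exact Or.inl rfl
    · exact Or.inr ⟨a, rfl⟩
  | distinguish a => exact Or.inr ⟨z, rfl⟩

/-- Two annotations of `A` embedded into the same structure, such that the embeddings agree on
`*` and, up to some `σ ∈ S`, on `A`, are isomorphic over that structure. -/
theorem exists_iso [L.IsRelational] {S : Subgroup (autGroup L A)} {α β : Annotation K A}
    {B : Type w} [L.Structure B] (p : α.toStructure ↪[L] B) (q : β.toStructure ↪[L] B)
    (hs : p α.star = q β.star) (σ : autGroup L A) (hσ : σ ∈ S)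
    (hi : ∀ a, p (α.incl a) = q (β.incl (σ.1 a))) :
    ∃ f : Iso S α β, q.comp f.toEquiv.toEmbedding = p := by
  have h1 : ∀ z : α.toStructure, ∃ y : β.toStructure, q y = p z := by
    intro z
    rcases α.cover z with rfl | ⟨a, rfl⟩
    · exact ⟨_, hs.symm⟩
    · exact ⟨_, (hi a).symm⟩
  have h2 : ∀ y : β.toStructure, ∃ z : α.toStructure, p z = q y := by
    intro y
    rcases β.cover y with rfl | ⟨a, rfl⟩
    · exact ⟨_, hs⟩
    · refine ⟨α.incl (σ.1.symm a), ?_⟩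
      rw [hi, Equiv.apply_symm_apply]
  choose f hf using h1
  choose g hg using h2
  let e : α.toStructure ≃[L] β.toStructure :=
    { toFun := f
      invFun := g
      left_inv := fun z => p.injective (by rw [hg, hf])
      right_inv := fun y => q.injective (by rw [hf, hg])
      map_fun' := fun {n} φ _ => ((inferInstance : IsEmpty (L.Functions n)).false φ).elim
      map_rel' := by
        intro n r z
        have h : (q ∘ (f ∘ z)) = p ∘ z := funext fun i => hf (z i)
        exact (q.map_rel r (f ∘ z)).symm.trans ((iff_of_eq (by rw [h])).trans (p.map_rel r z)) }
  have he : ∀ z, q (e z) = p z := hf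
  refine ⟨⟨e, ?_, σ, hσ, fun a => ?_⟩, ?_⟩
  · exact q.injective ((he _).trans hs)
  · exact q.injective ((he _).trans (hi a))
  · ext z
    exact he z

end Annotation

/-- Reading a data value `d` in a valuation `η` determines an annotation, together with the
embedding `η*` that extends `η` and maps `*` to `d`. -/
theorem exists_annotation [L.IsRelational] {K : Set (Bundled.{w} L.Structure)} {U : Type w}
    [L.Structure U] (hU : L.age U = K) {A : Type w} [L.Structure A]
    (hA : (⟨A, inferInstance⟩ : Bundled.{w} L.Structure) ∈ K) (η : A ↪[L] U) (d : U) :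
    ∃ (α : Annotation K A) (p : α.toStructure ↪[L] U),
      p α.star = d ∧ ∀ a, p (α.incl a) = η a := by
  by_cases h : ∃ a, η a = d
  · obtain ⟨a, ha⟩ := h
    exact ⟨.distinguish a, η, ha, fun _ => rfl⟩
  · let f : Option A → U := fun o => o.elim d η
    have hf : Function.Injective f := by
      rintro (_ | a) (_ | b) hab
      · rfl
      · exact (h ⟨b, hab.symm⟩).elim
      · exact (h ⟨a, hab⟩).elim
      · exact congrArg some (η.injective hab)
    let str : L.Structure (Option A) :=
      { funMap := fun {n} φ _ => ((inferInstance : IsEmpty (L.Functions n)).false φ).elim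
        RelMap := fun r a => Structure.RelMap r (fun i => f (a i)) }
    let p : @Language.Embedding L (Option A) U str _ :=
      letI := str
      { toFun := f
        inj' := hf
        map_fun' := fun {n} φ _ => ((inferInstance : IsEmpty (L.Functions n)).false φ).elim
        map_rel' := fun _ _ => Iff.rfl }
    have hm : (⟨Option A, str⟩ : Bundled.{w} L.Structure) ∈ K := by
      rw [← hU] at hA ⊢
      have : Finite A := Structure.FG.finite hA.1
      let := str
      exact ⟨Structure.FG.of_finite, ⟨p⟩⟩
    exact ⟨.extend str (fun n r a => η.map_rel r a) hm, p, rfl, fun _ => rfl⟩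

end Structures

/-! ### Fraïssé automata -/

section FraisseAutomata

variable {L : FirstOrder.Language.{u, v}}

/-- Compare a control state together with an embedding of its registers, with embeddings taken
modulo the register symmetries. -/
def classOf {Q : Type} {A : Q → Bundled.{w} L.Structure}
    (S : (q : Q) → Subgroup (autGroup L (A q))) {B : Type w} [L.Structure B]
    (y : Σ p : Q, A p ↪[L] B) : Σ p : Q, RegValuation (S p) B :=
  ⟨y.1, RegValuation.mk (S y.1) y.2⟩

/-- Compose with an embedding `f` of the target structure. -/
def push {Q : Type} {A : Q → Bundled.{w} L.Structure} {B C : Type w} [L.Structure B]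
    [L.Structure C] (f : B ↪[L] C) (y : Σ p : Q, A p ↪[L] B) : Σ p : Q, A p ↪[L] C :=
  ⟨y.1, f.comp y.2⟩

theorem classOf_push {Q : Type} {A : Q → Bundled.{w} L.Structure}
    (S : (q : Q) → Subgroup (autGroup L (A q))) {B C : Type w} [L.Structure B] [L.Structure C]
    (f : B ↪[L] C) {y z : Σ p : Q, A p ↪[L] B} (h : classOf S y = classOf S z) :
    classOf S (push f y) = classOf S (push f z) := by
  obtain ⟨p, a⟩ := y
  obtain ⟨p', b⟩ := z
  simp only [classOf, Sigma.mk.injEq] at h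
  obtain ⟨rfl, h⟩ := h
  obtain ⟨τ, hτ, rfl⟩ := Quotient.exact (eq_of_heq h)
  have : RegValuation.mk (S p) (f.comp a) = RegValuation.mk (S p) (f.comp (a.comp (autEmb τ))) :=
    Quotient.sound ⟨τ, hτ, rfl⟩
  exact congrArg (Sigma.mk p) this

/-- A Fraïssé `K`-automaton.  Each of the finitely many control states `q` carries a structure
representation: a structure `A q` of registers in `K` and a group `S q` of automorphisms of it,
the register symmetry.  The structure of registers in the initial state is empty.  The symbolic
transition function maps an annotation of `A q` to a control state `p` and an embedding of `A p`
into the annotation.  It respects the identification of annotations, and (this is the case of an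
automorphism of a single annotation) it commutes with the local symmetries: up to the register
symmetry of the target state, it commutes with isomorphisms of annotations modulo `S q`. -/
structure FraisseAutomaton [L.IsRelational] (K : Set (Bundled.{w} L.Structure)) where
  Q : Type
  finite_Q : Finite Q
  A : Q → Bundled.{w} L.Structure
  A_mem : ∀ q, A q ∈ K
  S : (q : Q) → Subgroup (autGroup L (A q))
  init : Q
  init_empty : IsEmpty (A init)
  accept : Set Q
  trans : (q : Q) → (α : Annotation K (A q)) → Σ p : Q, A p ↪[L] α.toStructure
  trans_iso : ∀ (q : Q) (α β : Annotation K (A q)) (f : Annotation.Iso (S q) α β),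
    classOf S (push f.toEquiv.toEmbedding (trans q α)) = classOf S (trans q β)

namespace FraisseAutomaton

variable [L.IsRelational] {K : Set (Bundled.{w} L.Structure)} (F : FraisseAutomaton K)
  {U : Type w} [L.Structure U]

/-- Configurations: a control state `q` with a valuation of its registers in the universal
structure, that is, an embedding of `A q` modulo the register symmetry `S q`. -/
def Config (U : Type w) [L.Structure U] : Type w :=
  Σ q : F.Q, RegValuation (F.S q) U

/-- Automorphisms of the universal structure act on configurations. -/
instance : MulAction (autGroup L U) (F.Config U) where
  smul π c := ⟨c.1, π • c.2⟩
  one_smul _ := Sigma.ext rfl (heq_of_eq (one_smul _ _))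
  mul_smul _ _ _ := Sigma.ext rfl (heq_of_eq (mul_smul _ _ _))

theorem smul_mk (π : autGroup L U) (q : F.Q) (a : RegValuation (F.S q) U) :
    π • (⟨q, a⟩ : F.Config U) = (⟨q, π • a⟩ : F.Config U) := rfl

theorem smul_classOf (π : autGroup L U) (y : Σ p : F.Q, F.A p ↪[L] U) :
    π • (classOf F.S y : F.Config U) = classOf F.S (push (autEmb π) y) := rfl

variable (hU : L.age U = K)

/-- The annotation of `A q` determined by the valuation `η` and the input letter `d`. -/
noncomputable def annotation (q : F.Q) (η : F.A q ↪[L] U) (d : U) : Annotation K (F.A q) :=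
  (exists_annotation hU (F.A_mem q) η d).choose

/-- The embedding `η*` of this annotation, which extends `η` and maps `*` to `d`. -/
noncomputable def extension (q : F.Q) (η : F.A q ↪[L] U) (d : U) :
    (F.annotation hU q η d).toStructure ↪[L] U :=
  (exists_annotation hU (F.A_mem q) η d).choose_spec.choose

theorem extension_star (q : F.Q) (η : F.A q ↪[L] U) (d : U) :
    F.extension hU q η d (F.annotation hU q η d).star = d :=
  (exists_annotation hU (F.A_mem q) η d).choose_spec.choose_spec.1

theorem extension_incl (q : F.Q) (η : F.A q ↪[L] U) (d : U) (a : F.A q) :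
    F.extension hU q η d ((F.annotation hU q η d).incl a) = η a :=
  (exists_annotation hU (F.A_mem q) η d).choose_spec.choose_spec.2 a

/-- In state `q` with valuation `η`, on input `d`: apply the symbolic transition function to the
annotation determined by `η` and `d`, and compose the result with `η*`. -/
noncomputable def stepRep (q : F.Q) (η : F.A q ↪[L] U) (d : U) : F.Config U :=
  classOf F.S (push (F.extension hU q η d) (F.trans q (F.annotation hU q η d)))

/-- The step can be computed with any annotation and any embedding of it that represent the
configuration and the letter. -/
theorem stepRep_eq (q : F.Q) (η : F.A q ↪[L] U) (d : U) (α : Annotation K (F.A q))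
    (p : α.toStructure ↪[L] U) (hs : p α.star = d) (σ : autGroup L (F.A q)) (hσ : σ ∈ F.S q)
    (hi : ∀ a, p (α.incl a) = η (σ.1 a)) :
    classOf F.S (push p (F.trans q α)) = F.stepRep hU q η d := by
  obtain ⟨f, hf⟩ := Annotation.exists_iso (S := F.S q) p (F.extension hU q η d)
    (hs.trans (F.extension_star hU q η d).symm) σ hσ
    (fun a => (hi a).trans (F.extension_incl hU q η d _).symm)
  have h := classOf_push F.S (F.extension hU q η d) (F.trans_iso q _ _ f)
  refine Eq.trans ?_ h
  subst hf
  rfl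

/-- The transition function on configurations. -/
noncomputable def stepVal (q : F.Q) (a : RegValuation (F.S q) U) (d : U) : F.Config U :=
  Quotient.liftOn a (fun η => F.stepRep hU q η d) (by
    rintro η _ ⟨τ, hτ, rfl⟩
    exact (F.stepRep_eq hU q η d _ _ (F.extension_star hU q _ d) τ hτ
      (fun a => F.extension_incl hU q _ d a)).symm)

/-- The valuation of the (empty set of) registers in the initial state. -/
noncomputable def initVal : F.A F.init ↪[L] U :=
  (show F.A F.init ∈ L.age U from hU ▸ F.A_mem F.init).2.some

/-- The `G`-automaton over the alphabet `U` induced by a Fraïssé automaton, where `U` is a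
structure with age `K` and `G` its automorphism group. -/
noncomputable def toDetAutomaton : DetAutomaton (autGroup L U) U (F.Config U) where
  step c d := F.stepVal hU c.1 c.2 d
  start := ⟨F.init, RegValuation.mk (F.S F.init) (F.initVal hU)⟩
  accept := {c | c.1 ∈ F.accept}
  start_equivariant π := by
    have := F.init_empty
    refine congrArg (fun p => (⟨F.init, RegValuation.mk (F.S F.init) p⟩ : F.Config U)) ?_
    ext a
    exact isEmptyElim a
  accept_equivariant _ _ := Iff.rfl
  step_equivariant := by
    rintro π ⟨q, ⟨η⟩⟩ d
    refine (F.stepRep_eq hU q ((autEmb π).comp η) (π • d) (F.annotation hU q η d)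
      ((autEmb π).comp (F.extension hU q η d)) ?_ 1 (F.S q).one_mem fun a => ?_).symm
    · simp only [Embedding.comp_apply, extension_star]; rfl
    · simp only [Embedding.comp_apply, extension_incl]; rfl

end FraisseAutomaton

end FraisseAutomata

end NominalAutomata

namespace NominalAutomata

open FirstOrder FirstOrder.Language

open CategoryTheory (Bundled)

/-! ### Supports -/

section Supports

variable {D : Type w} {G : Subgroup (Equiv.Perm D)} {X : Type x} [MulAction G X]

/-! Pick a point `x` in each of the finitely many orbits of the state set. Its least support is
finite; the substructure of `U` induced on it serves as register structure, and the restrictions to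
it of automorphisms fixing `x` form the local symmetry. Ultrahomogeneity writes every embedding of
the registers as `π` after the inclusion, and this embedding is taken to name the state `π • x`. The
name is well defined because the registers support `x`. Two embeddings name the same state exactly
when they differ by a local symmetry, because an automorphism fixing `x` preserves its least support
(`OrbitSystem.classOf_eq_iff`). So configurations correspond bijectively and equivariantly to
states.

A transition from `x` on `d` leads to a state supported by the registers of `x` together with `d`,
that is, by an embedded annotation. The registers of the target therefore lie inside the annotation,
which yields the symbolic transition (`OrbitSystem.exists_trans`); equivariance extends its
correctness to all configurations (`OrbitSystem.element_push_trans_eq`).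

For languages, this representation is applied to the syntactic automaton. Conversely, homogeneity
makes configurations with the same control state lie in one orbit, so a Fraïssé automaton induces a
`G`-DFA; and the orbits of the syntactic quotient inject into the orbits of states of any
recognizing `G`-DFA. -/

theorem Supports.smul {C : Set D} {a : X} (h : Supports G C a) (π : G) :
    Supports G ((π • ·) '' C) (π • a) := by
  intro ρ hρ
  have hfix : (π⁻¹ * ρ * π) • a = a := by
    refine h _ fun c hc => ?_
    rw [mul_smul, mul_smul, hρ (π • c) ⟨c, hc, rfl⟩, inv_smul_smul]
  rw [mul_smul, mul_smul, inv_smul_eq_iff] at hfix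
  exact hfix

theorem Supports.of_smul {C : Set D} {a : X} {π : G} (h : Supports G C (π • a)) :
    Supports G ((π⁻¹ • ·) '' C) a := by
  simpa using h.smul π⁻¹

/-- Removes the universe restriction in the hypothesis: the coset of `g` modulo the stabilizer of
`a` has the same supports as `g • a`, and the coset space lives in the universe of `D`. -/
theorem AdmitsLeastSupports.exists_isLeast (hL : AdmitsLeastSupports G) (hX : IsNominal G X)
    (a : X) : ∃ C : Set D, IsLeast {C' : Set D | C'.Finite ∧ Supports G C' a} C := by
  let H := MulAction.stabilizer G a
  have key : ∀ (C : Set D) (g : G), Supports G C (g : G ⧸ H) ↔ Supports G C (g • a) := by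
    intro C g
    refine forall_congr' fun π => imp_congr_right fun _ => ?_
    rw [MulAction.Quotient.smul_coe, eq_comm, QuotientGroup.eq, MulAction.mem_stabilizer_iff,
      mul_smul, inv_smul_eq_iff, smul_eq_mul, mul_smul]
  obtain ⟨C, hC⟩ := hL (G ⧸ H) (by
    rintro ⟨g⟩
    obtain ⟨C, hC, hs⟩ := hX (g • a)
    exact ⟨C, hC, (key C g).2 hs⟩) ((1 : G) : G ⧸ H)
  refine ⟨C, ?_⟩
  simpa only [key, one_smul] using hC

end Supports

/-! ### Ultrahomogeneity -/

section Homogeneous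

variable {L : FirstOrder.Language.{u, v}} {U : Type w} [L.Structure U]

theorem exists_autGroup_smul_eq (hU : L.IsUltrahomogeneous U) {A : Type w} [L.Structure A]
    (hA : Structure.FG L A) (p q : A ↪[L] U) : ∃ π : autGroup L U, ∀ a, π • p a = q a := by
  obtain ⟨g, hg⟩ := hU p.toHom.range (hA.range _) (q.comp p.equivRange.symm.toEmbedding)
  refine ⟨⟨g.toEquiv, g, fun _ => rfl⟩, fun a => ?_⟩
  have h : q (p.equivRange.symm (p.equivRange a)) = g (p a) :=
    DFunLike.congr_fun hg (p.equivRange a)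
  rw [Language.Equiv.symm_apply_apply] at h
  exact h.symm

/-- The automorphism group of the Fraïssé limit has finitely many orbits on points, if the
signature is finite: the orbit of a point is given by the relations on constant tuples. -/
theorem orbitFinite_carrier [L.IsRelational] [Finite (Σ n, L.Relations n)]
    (hU : L.IsUltrahomogeneous U) : OrbitFinite (autGroup L U) U := by
  let type : U → (Σ n, L.Relations n) → Prop := fun d r => Structure.RelMap r.2 fun _ => d
  have key : ∀ d e : U, type d = type e → ∃ π : autGroup L U, π • d = e := by
    intro d e h
    -- The one-point structure with the common type of `d` and `e`; homogeneity relates its two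
    -- embeddings.
    let str : L.Structure PUnit.{w + 1} :=
      { funMap := fun {n} φ _ => ((inferInstance : IsEmpty (L.Functions n)).false φ).elim
        RelMap := fun {n} r _ => type d ⟨n, r⟩ }
    have emb : ∀ c : U, type d = type c → ∃ p : PUnit.{w + 1} ↪[L] U, ∀ z, p z = c := by
      intro c hc
      exact ⟨{ toFun := fun _ => c
               inj' := fun _ _ _ => rfl
               map_fun' := fun {n} φ _ =>
                ((inferInstance : IsEmpty (L.Functions n)).false φ).elim
               map_rel' := fun {n} r a => (iff_of_eq (congrFun hc ⟨n, r⟩)).symm },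
        fun _ => rfl⟩
    obtain ⟨p, hp⟩ := emb d rfl
    obtain ⟨q, hq⟩ := emb e h
    obtain ⟨π, hπ⟩ := exists_autGroup_smul_eq hU Structure.FG.of_finite p q
    exact ⟨π, by simpa only [hp, hq] using hπ PUnit.unit⟩
  refine Finite.of_injective (fun o : MulAction.orbitRel.Quotient (autGroup L U) U =>
    type o.out) fun o o' h => ?_
  obtain ⟨π, hπ⟩ := key _ _ h
  rw [← Quotient.out_eq o, ← Quotient.out_eq o']
  exact (Quotient.sound (s := MulAction.orbitRel _ _) ⟨π, hπ⟩).symm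

theorem isNominal_carrier : IsNominal (autGroup L U) U :=
  fun d => ⟨{d}, Set.finite_singleton d, fun _ h => h d rfl⟩

end Homogeneous

/-! ### Representing nominal sets by register structures -/

section OrbitSystem

variable {L : FirstOrder.Language.{u, v}}

/-- A choice of one point in each of the finitely many orbits of a nominal `Aut U`-set, with a
structure embedded into `U` onto the least finite support of the point. -/
structure OrbitSystem (L : FirstOrder.Language.{u, v}) (U : Type w) [L.Structure U]
    (X : Type x) [MulAction (autGroup L U) X] where
  Q : Type
  finite_Q : Finite Q
  A : Q → Bundled.{w} L.Structure
  finite_A : ∀ q, Finite (A q)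
  emb : ∀ q, A q ↪[L] U
  point : Q → X
  supports : ∀ q, Supports (autGroup L U) (Set.range (emb q)) (point q)
  least : ∀ q (C : Set U), C.Finite → Supports (autGroup L U) C (point q) →
    Set.range (emb q) ⊆ C
  orbit_injective : ∀ (q q' : Q) (π : autGroup L U), π • point q = point q' → q = q'
  orbit_surjective : ∀ y : X, ∃ (q : Q) (π : autGroup L U), π • point q = y

theorem OrbitSystem.exists_of_leastSupports [L.IsRelational] {U : Type w} [L.Structure U]
    {X : Type x} [MulAction (autGroup L U) X] (hL : AdmitsLeastSupports (autGroup L U))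
    (hX : IsNominal (autGroup L U) X) (hf : OrbitFinite (autGroup L U) X) :
    Nonempty (OrbitSystem L U X) := by
  have : Finite (MulAction.orbitRel.Quotient (autGroup L U) X) := hf
  obtain ⟨n, ⟨e⟩⟩ := Finite.exists_equiv_fin (MulAction.orbitRel.Quotient (autGroup L U) X)
  let point : Fin n → X := fun q => (e.symm q).out
  have hpoint : ∀ q, e (Quotient.mk _ (point q)) = q := fun q => by
    rw [Quotient.out_eq, Equiv.apply_symm_apply]
  choose C hC using fun q => hL.exists_isLeast hX (point q)
  -- Without function symbols, every subset carries a substructure, in particular the least support.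
  let A : Fin n → L.Substructure U := fun q =>
    ⟨C q, fun {m} f => ((inferInstance : IsEmpty (L.Functions m)).false f).elim⟩
  have hA : ∀ q, Set.range (A q).subtype = C q := fun q => by
    ext c
    exact ⟨fun ⟨a, ha⟩ => ha ▸ a.2, fun hc => ⟨⟨c, hc⟩, rfl⟩⟩
  exact ⟨{
    Q := Fin n
    finite_Q := inferInstance
    A := fun q => ⟨A q, inferInstance⟩
    finite_A := fun q => (hC q).1.1
    emb := fun q => (A q).subtype
    point := point
    supports := fun q => by
      rw [hA]
      exact (hC q).1.2
    least := fun q C' hf hs => by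
      rw [hA]
      exact (hC q).2 ⟨hf, hs⟩
    orbit_injective := fun q q' π h => by
      rw [← hpoint q, ← hpoint q']
      exact congrArg e (Quotient.sound (s := MulAction.orbitRel _ _) ⟨π, h⟩).symm
    orbit_surjective := fun y => by
      refine ⟨e (Quotient.mk _ y), ?_⟩
      have h : (MulAction.orbitRel (autGroup L U) X) y (point (e (Quotient.mk _ y))) := by
        refine Quotient.exact ?_
        apply e.injective
        rw [hpoint]
      exact h }⟩

namespace OrbitSystem

variable {U : Type w} [L.Structure U] {X : Type x} [MulAction (autGroup L U) X]
  (R : OrbitSystem L U X)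

theorem A_mem_age (q : R.Q) : R.A q ∈ L.age U :=
  have := R.finite_A q
  ⟨Structure.FG.of_finite, ⟨R.emb q⟩⟩

/-- The register symmetry: restrictions of automorphisms that fix the chosen point. -/
def S (q : R.Q) : Subgroup (autGroup L (R.A q)) where
  carrier := {σ | ∃ π : autGroup L U, π • R.point q = R.point q ∧
    ∀ a, π • R.emb q a = R.emb q (σ.1 a)}
  one_mem' := ⟨1, one_smul _ _, fun a => one_smul _ _⟩
  mul_mem' := by
    rintro σ τ ⟨π, h, hπ⟩ ⟨ρ, h', hρ⟩
    refine ⟨π * ρ, by rw [mul_smul, h', h], fun a => ?_⟩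
    rw [mul_smul, hρ, hπ]
    rfl
  inv_mem' := by
    rintro σ ⟨π, h, hπ⟩
    refine ⟨π⁻¹, by rw [inv_smul_eq_iff, h], fun a => ?_⟩
    rw [inv_smul_eq_iff, hπ]
    exact congrArg (R.emb q) (Equiv.apply_symm_apply σ.1 a).symm

/-- `ρ⁻¹ * π` is the identity on a support of the point. -/
theorem smul_point_eq {q : R.Q} {π ρ : autGroup L U}
    (h : ∀ a, π • R.emb q a = ρ • R.emb q a) : π • R.point q = ρ • R.point q := by
  have hfix : (ρ⁻¹ * π) • R.point q = R.point q := by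
    refine R.supports q _ ?_
    rintro _ ⟨a, rfl⟩
    rw [mul_smul, h, inv_smul_smul]
  rwa [mul_smul, inv_smul_eq_iff] at hfix

/-- If `π` fixes the point, the preimage of its support under `π` is again a finite support, hence
contains the least one. -/
theorem smul_mem_range {q : R.Q} {π : autGroup L U} (h : π • R.point q = R.point q)
    (a : R.A q) : π • R.emb q a ∈ Set.range (R.emb q) := by
  have hs : Supports (autGroup L U) (Set.range (R.emb q)) (π • R.point q) := by
    rw [h]
    exact R.supports q
  have := R.finite_A q
  obtain ⟨_, ⟨b, rfl⟩, hb⟩ :=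
    R.least q _ ((Set.finite_range _).image _) hs.of_smul ⟨a, rfl⟩
  exact ⟨b, by rw [← hb]; simp⟩

/-- An automorphism that fixes the chosen point restricts to an element of the register
symmetry. -/
theorem exists_mem_S [L.IsRelational] {q : R.Q} {π : autGroup L U}
    (h : π • R.point q = R.point q) : ∃ σ ∈ R.S q, ∀ a, π • R.emb q a = R.emb q (σ.1 a) := by
  have h' : π⁻¹ • R.point q = R.point q := by rw [inv_smul_eq_iff, h]
  choose f hf using R.smul_mem_range h
  -- `π⁻¹` fixes the point as well, so its restriction is the inverse of `f`.
  choose g hg using R.smul_mem_range h'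
  let e : R.A q ≃[L] R.A q :=
    { toFun := f
      invFun := g
      left_inv := fun a => (R.emb q).injective (by rw [hg, hf, inv_smul_smul])
      right_inv := fun a => (R.emb q).injective (by rw [hf, hg, smul_inv_smul])
      map_fun' := fun {n} φ _ => ((inferInstance : IsEmpty (L.Functions n)).false φ).elim
      map_rel' := by
        intro n r a
        have hc : R.emb q ∘ (f ∘ a) = (autEmb π) ∘ (R.emb q ∘ a) := funext fun i => hf (a i)
        exact ((R.emb q).map_rel r (f ∘ a)).symm.trans ((iff_of_eq (by rw [hc])).trans
          (((autEmb π).map_rel r _).trans ((R.emb q).map_rel r a))) }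
  exact ⟨⟨e.toEquiv, e, fun _ => rfl⟩, ⟨π, h, fun a => (hf a).symm⟩, fun a => (hf a).symm⟩

theorem exists_extension (hU : L.IsUltrahomogeneous U) (y : Σ q : R.Q, R.A q ↪[L] U) :
    ∃ π : autGroup L U, ∀ a, π • R.emb y.1 a = y.2 a :=
  have := R.finite_A y.1
  exists_autGroup_smul_eq hU Structure.FG.of_finite _ _

variable (hU : L.IsUltrahomogeneous U)

/-- The element named by a control state and an embedding of its registers. -/
noncomputable def element (y : Σ q : R.Q, R.A q ↪[L] U) : X :=
  (R.exists_extension hU y).choose • R.point y.1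

theorem element_eq {y : Σ q : R.Q, R.A q ↪[L] U} {π : autGroup L U}
    (h : ∀ a, π • R.emb y.1 a = y.2 a) : R.element hU y = π • R.point y.1 :=
  R.smul_point_eq fun a => ((R.exists_extension hU y).choose_spec a).trans (h a).symm

theorem element_push (π : autGroup L U) (y : Σ q : R.Q, R.A q ↪[L] U) :
    R.element hU (push (autEmb π) y) = π • R.element hU y := by
  obtain ⟨ρ, hρ⟩ := R.exists_extension hU y
  rw [R.element_eq hU hρ, ← mul_smul]
  refine R.element_eq hU fun a => ?_
  rw [mul_smul]
  exact congrArg (π • ·) (hρ a)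

theorem element_surjective : Function.Surjective (R.element hU) := by
  intro x
  obtain ⟨q, π, rfl⟩ := R.orbit_surjective x
  exact ⟨⟨q, (autEmb π).comp (R.emb q)⟩, R.element_eq hU fun _ => rfl⟩

/-- Minimality of the chosen support, transported along an automorphism that extends `y.2`. -/
theorem range_subset_of_supports {y : Σ q : R.Q, R.A q ↪[L] U} {C : Set U} (hC : C.Finite)
    (h : Supports (autGroup L U) C (R.element hU y)) : Set.range y.2 ⊆ C := by
  obtain ⟨π, hπ⟩ := R.exists_extension hU y
  rw [R.element_eq hU hπ] at h
  rintro _ ⟨a, rfl⟩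
  obtain ⟨c, hc, hca⟩ := R.least _ _ (hC.image _) h.of_smul ⟨a, rfl⟩
  rw [← hπ, ← hca]
  simpa using hc

/-- The faithfulness of the representation. Elements of `R.S` come from automorphisms fixing the
point, which gives one direction. Conversely, equal elements lie in one orbit, so the control states
agree, and the quotient of the two extending automorphisms fixes the point and thus restricts to an
element of `R.S`. -/
theorem classOf_eq_iff [L.IsRelational] {y z : Σ q : R.Q, R.A q ↪[L] U} :
    classOf R.S y = classOf R.S z ↔ R.element hU y = R.element hU z := by
  obtain ⟨q, η⟩ := y
  obtain ⟨q', θ⟩ := z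
  obtain ⟨π, hπ⟩ := R.exists_extension hU ⟨q, η⟩
  obtain ⟨ρ, hρ⟩ := R.exists_extension hU ⟨q', θ⟩
  constructor
  · intro h
    simp only [classOf, Sigma.mk.injEq] at h
    obtain ⟨rfl, h⟩ := h
    obtain ⟨τ, ⟨κ, hκ, hτ⟩, rfl⟩ := Quotient.exact (eq_of_heq h)
    rw [R.element_eq hU hπ, R.element_eq hU (π := π * κ), mul_smul, hκ]
    intro a
    rw [mul_smul, hτ]
    exact hπ _
  · intro h
    rw [R.element_eq hU hπ, R.element_eq hU hρ, eq_comm, ← inv_smul_eq_iff, ← mul_smul] at h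
    simp only at h hπ hρ
    obtain rfl : q' = q := R.orbit_injective q' q _ h
    obtain ⟨σ, hσ, hσ'⟩ := R.exists_mem_S h
    refine congrArg (Sigma.mk _) (Quotient.sound ⟨σ, hσ, ?_⟩)
    ext a
    have := hσ' a
    rw [mul_smul, inv_smul_eq_iff] at this
    exact ((hπ _).symm.trans this.symm).trans (hρ a)

end OrbitSystem

end OrbitSystem

/-! ### From automata to Fraïssé automata -/

section Representation

variable {L : FirstOrder.Language.{u, v}}

/-- The local symmetry acts on the source side, so the same `τ` works after cancelling the injective
`f`. This lets classes of embeddings into an annotation be compared inside `U`. -/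
theorem classOf_push_injective {Q : Type} {A : Q → Bundled.{w} L.Structure}
    {S : (q : Q) → Subgroup (autGroup L (A q))} {B C : Type w} [L.Structure B] [L.Structure C]
    (f : B ↪[L] C) {y z : Σ p : Q, A p ↪[L] B}
    (h : classOf S (push f y) = classOf S (push f z)) : classOf S y = classOf S z := by
  obtain ⟨p, a⟩ := y
  obtain ⟨p', b⟩ := z
  change (⟨p, RegValuation.mk _ (f.comp a)⟩ : Σ p, RegValuation (S p) C) =
    ⟨p', RegValuation.mk _ (f.comp b)⟩ at h
  rw [Sigma.mk.injEq] at h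
  obtain ⟨rfl, h⟩ := h
  obtain ⟨τ, hτ, he⟩ := Quotient.exact (eq_of_heq h)
  refine congrArg (Sigma.mk p) (Quotient.sound ⟨τ, hτ, ?_⟩)
  ext c
  exact f.injective (DFunLike.congr_fun he c)

theorem push_push {Q : Type} {A : Q → Bundled.{w} L.Structure} {B C D : Type w}
    [L.Structure B] [L.Structure C] [L.Structure D] (f : B ↪[L] C) (g : C ↪[L] D)
    (y : Σ p : Q, A p ↪[L] B) : push g (push f y) = push (g.comp f) y := rfl

/-- An isomorphism of automata from a bijection in the opposite direction. -/
noncomputable def DetAutomaton.Iso.ofBijective {D : Type w} {G : Subgroup (Equiv.Perm D)}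
    {A : Type w} [MulAction G A] {X : Type x} [MulAction G X] {Y : Type*} [MulAction G Y]
    {M : DetAutomaton G A X} {N : DetAutomaton G A Y} (f : Y → X) (hf : Function.Bijective f)
    (map_smul : ∀ (π : G) (c : Y), f (π • c) = π • f c) (map_start : f N.start = M.start)
    (map_accept : ∀ c : Y, f c ∈ M.accept ↔ c ∈ N.accept)
    (map_step : ∀ (c : Y) (a : A), f (N.step c a) = M.step (f c) a) : M.Iso N where
  toEquiv := (Equiv.ofBijective f hf).symm
  map_smul π q := by
    obtain ⟨c, rfl⟩ := hf.2 q
    exact hf.1 (by simp [Equiv.ofBijective_apply_symm_apply, map_smul])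
  map_start := hf.1 (by simp [Equiv.ofBijective_apply_symm_apply, map_start])
  map_accept q := by
    obtain ⟨c, rfl⟩ := hf.2 q
    simp [map_accept]
  map_step q a := by
    obtain ⟨c, rfl⟩ := hf.2 q
    exact hf.1 (by simp [Equiv.ofBijective_apply_symm_apply, map_step])

theorem Annotation.finite_toStructure {K : Set (Bundled.{w} L.Structure)} {A : Type w}
    [L.Structure A] [h : Finite A] (α : Annotation K A) : Finite α.toStructure := by
  cases α with
  | extend str cons mem => exact inferInstanceAs (Finite (Option A))
  | distinguish a => exact h

namespace OrbitSystem

variable [L.IsRelational] {K : Set (Bundled.{w} L.Structure)} {U : Type w} [L.Structure U]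
  {X : Type x} [MulAction (autGroup L U) X] (R : OrbitSystem L U X)

/-- The annotation lies in the age, so it embeds somehow; homogeneity then moves its copy of the
registers onto the chosen one. -/
theorem exists_annotationEmb (hU : L.IsUltrahomogeneous U) (hage : L.age U = K) (q : R.Q)
    (α : Annotation K (R.A q)) :
    ∃ p : α.toStructure ↪[L] U, ∀ a, p (α.incl a) = R.emb q a := by
  have hα : α.toStructure ∈ L.age U := by
    cases α with
    | extend str cons mem => exact hage ▸ mem
    | distinguish a => exact R.A_mem_age q
  obtain ⟨p⟩ := hα.2
  obtain ⟨π, hπ⟩ := exists_autGroup_smul_eq hU (R.A_mem_age q).1 (p.comp α.incl) (R.emb q)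
  exact ⟨(autEmb π).comp p, hπ⟩

variable (hU : L.IsUltrahomogeneous U) (hage : L.age U = K)

/-- An embedding of an annotation that extends the chosen embedding of the registers. -/
noncomputable def annotationEmb (q : R.Q) (α : Annotation K (R.A q)) : α.toStructure ↪[L] U :=
  (R.exists_annotationEmb hU hage q α).choose

theorem annotationEmb_incl (q : R.Q) (α : Annotation K (R.A q)) (a : R.A q) :
    R.annotationEmb hU hage q α (α.incl a) = R.emb q a :=
  (R.exists_annotationEmb hU hage q α).choose_spec a

variable (M : DetAutomaton (autGroup L U) U X)

/-- The source of the symbolic transitions: the successor state is supported by the embedded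
annotation, so its least support lies there and its register embedding factors through `p`. -/
theorem exists_trans (q : R.Q) (α : Annotation K (R.A q)) :
    ∃ y : Σ p : R.Q, R.A p ↪[L] α.toStructure,
      R.element hU (push (R.annotationEmb hU hage q α) y) =
        M.step (R.point q) (R.annotationEmb hU hage q α α.star) := by
  let p := R.annotationEmb hU hage q α
  obtain ⟨z, hz⟩ := R.element_surjective hU (M.step (R.point q) (p α.star))
  have := R.finite_A q
  have := α.finite_toStructure
  -- The range contains both the input letter and the support of the source state, so equivariance
  -- of the step applies.
  have hs : Supports (autGroup L U) (Set.range p) (R.element hU z) := by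
    intro π hπ
    rw [hz, ← M.step_equivariant, hπ _ ⟨α.star, rfl⟩, R.supports q π]
    rintro _ ⟨a, rfl⟩
    exact hπ _ ⟨α.incl a, R.annotationEmb_incl hU hage q α a⟩
  have hsub := R.range_subset_of_supports hU (Set.finite_range p) hs
  choose f hf using fun a => hsub ⟨a, rfl⟩
  refine ⟨⟨z.1, { toFun := f
                  inj' := fun a b h => z.2.injective (by rw [← hf, ← hf, h])
                  map_fun' := fun {n} φ _ =>
                    ((inferInstance : IsEmpty (L.Functions n)).false φ).elim
                  map_rel' := fun {n} r a => ?_ }⟩, ?_⟩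
  · have hc : p ∘ (f ∘ a) = z.2 ∘ a := funext fun i => hf (a i)
    exact (p.map_rel r (f ∘ a)).symm.trans ((iff_of_eq (by rw [hc])).trans (z.2.map_rel r a))
  · rw [← hz]
    congr 1
    refine Sigma.ext rfl (heq_of_eq ?_)
    ext a
    exact hf a

/-- The Fraïssé automaton that represents `M`. -/
noncomputable def fraisseAutomaton : FraisseAutomaton K where
  Q := R.Q
  finite_Q := R.finite_Q
  A := R.A
  A_mem q := hage ▸ R.A_mem_age q
  S := R.S
  init := (R.element_surjective hU M.start).choose.1
  -- The initial state is fixed by the whole group, so the empty set supports it and its least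
  -- support is empty.
  init_empty := by
    have h := R.range_subset_of_supports hU (y := (R.element_surjective hU M.start).choose)
      Set.finite_empty (fun π _ => by
        rw [(R.element_surjective hU M.start).choose_spec]
        exact M.start_equivariant π)
    exact ⟨fun a => h ⟨a, rfl⟩⟩
  accept := {q | R.point q ∈ M.accept}
  trans q α := (R.exists_trans hU hage M q α).choose
  trans_iso q α β f := by
    let p := R.annotationEmb hU hage q α
    let r := R.annotationEmb hU hage q β
    -- The isomorphism of annotations is realized by an automorphism of `U`; equivariance of `M`
    -- under it will give compatibility.
    obtain ⟨π, hπ⟩ : ∃ π : autGroup L U, ∀ z, π • p z = r (f.toEquiv z) := by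
      have := R.finite_A q
      have := α.finite_toStructure
      exact exists_autGroup_smul_eq hU Structure.FG.of_finite p (r.comp f.toEquiv.toEmbedding)
    obtain ⟨σ, ⟨ρ, hρ, hσ⟩, hf⟩ := f.map_incl
    -- On the registers `π` agrees with `ρ`, which witnesses `σ ∈ R.S q` and fixes the point.
    have hpoint : π • R.point q = R.point q := by
      rw [R.smul_point_eq (π := π) (ρ := ρ), hρ]
      intro a
      rw [← R.annotationEmb_incl hU hage q α a]
      refine (hπ _).trans ?_
      rw [hf]
      exact (R.annotationEmb_incl hU hage q β _).trans
        ((hσ a).symm.trans (by rw [R.annotationEmb_incl]))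
    refine classOf_push_injective r ((R.classOf_eq_iff hU).2 ?_)
    rw [(R.exists_trans hU hage M q β).choose_spec, push_push]
    have hc : r.comp f.toEquiv.toEmbedding = (autEmb π).comp p := by
      ext z
      exact (hπ z).symm
    rw [hc, ← push_push, R.element_push, (R.exists_trans hU hage M q α).choose_spec,
      ← M.step_equivariant, hpoint]
    congr 1
    exact (hπ _).trans (by rw [f.map_star])

theorem element_push_trans (q : R.Q) (α : Annotation K (R.A q)) :
    R.element hU (push (R.annotationEmb hU hage q α)
      ((R.fraisseAutomaton hU hage M).trans q α)) =
        M.step (R.point q) (R.annotationEmb hU hage q α α.star) :=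
  (R.exists_trans hU hage M q α).choose_spec

/-- The symbolic transition function computes the step of `M`. -/
theorem element_push_trans_eq (q : R.Q) (η : R.A q ↪[L] U) (d : U) (α : Annotation K (R.A q))
    (p : α.toStructure ↪[L] U) (hs : p α.star = d) (hi : ∀ a, p (α.incl a) = η a) :
    R.element hU (push p ((R.fraisseAutomaton hU hage M).trans q α)) =
      M.step (R.element hU ⟨q, η⟩) d := by
  let y : Σ p : R.Q, R.A p ↪[L] α.toStructure := (R.fraisseAutomaton hU hage M).trans q α
  let r := R.annotationEmb hU hage q α
  have hy : R.element hU (push r y) = M.step (R.point q) (r α.star) :=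
    R.element_push_trans hU hage M q α
  have := R.finite_A q
  have := α.finite_toStructure
  -- The transition was specified only for the embedding `r`; an automorphism carries it to the
  -- given `p`.
  obtain ⟨π, hπ⟩ := exists_autGroup_smul_eq hU Structure.FG.of_finite r p
  have hp : p = (autEmb π).comp r := by
    ext z
    exact (hπ z).symm
  change R.element hU (push p y) = _
  rw [hp, ← push_push, R.element_push, hy, ← M.step_equivariant,
    R.element_eq hU (y := ⟨q, η⟩) (π := π)]
  · congr 1
    exact (hπ _).trans hs
  · intro a
    rw [← R.annotationEmb_incl hU hage q α a]
    exact (hπ _).trans (hi a)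

/-- The state of `M` that a configuration represents. -/
noncomputable def ofConfig (c : (R.fraisseAutomaton hU hage M).Config U) : X :=
  R.element hU ⟨c.1, Quotient.out c.2⟩

theorem ofConfig_classOf (y : Σ q : R.Q, R.A q ↪[L] U) :
    R.ofConfig hU hage M (classOf R.S y) = R.element hU y :=
  (R.classOf_eq_iff hU).1 (congrArg (Sigma.mk y.1) (Quotient.out_eq _))

theorem exists_classOf_eq (c : (R.fraisseAutomaton hU hage M).Config U) :
    ∃ y : Σ q : R.Q, R.A q ↪[L] U, classOf R.S y = c :=
  ⟨⟨c.1, Quotient.out c.2⟩, congrArg (Sigma.mk c.1) (Quotient.out_eq c.2)⟩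

theorem ofConfig_bijective : Function.Bijective (R.ofConfig hU hage M) := by
  constructor
  · intro c d h
    obtain ⟨y, rfl⟩ := R.exists_classOf_eq hU hage M c
    obtain ⟨z, rfl⟩ := R.exists_classOf_eq hU hage M d
    rw [ofConfig_classOf, ofConfig_classOf] at h
    exact (R.classOf_eq_iff hU).2 h
  · intro x
    obtain ⟨y, rfl⟩ := R.element_surjective hU x
    exact ⟨_, R.ofConfig_classOf hU hage M y⟩

theorem ofConfig_smul (π : autGroup L U) (c : (R.fraisseAutomaton hU hage M).Config U) :
    R.ofConfig hU hage M (π • c) = π • R.ofConfig hU hage M c := by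
  obtain ⟨y, rfl⟩ := R.exists_classOf_eq hU hage M c
  rw [ofConfig_classOf, ← R.element_push]
  exact R.ofConfig_classOf hU hage M (push (autEmb π) y)

theorem ofConfig_step (c : (R.fraisseAutomaton hU hage M).Config U) (d : U) :
    R.ofConfig hU hage M (((R.fraisseAutomaton hU hage M).toDetAutomaton hage).step c d) =
      M.step (R.ofConfig hU hage M c) d := by
  obtain ⟨⟨q, η⟩, rfl⟩ := R.exists_classOf_eq hU hage M c
  rw [ofConfig_classOf]
  exact (R.ofConfig_classOf hU hage M (push _ _)).trans
    (R.element_push_trans_eq hU hage M q η d _ _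
      ((R.fraisseAutomaton hU hage M).extension_star hage q η d)
      ((R.fraisseAutomaton hU hage M).extension_incl hage q η d))

theorem nonempty_iso :
    Nonempty (M.Iso ((R.fraisseAutomaton hU hage M).toDetAutomaton hage)) := by
  refine ⟨.ofBijective (R.ofConfig hU hage M) (R.ofConfig_bijective hU hage M)
    (R.ofConfig_smul hU hage M) ?_ ?_ (R.ofConfig_step hU hage M)⟩
  · have hs := (R.element_surjective hU M.start).choose_spec
    have hempty := (R.fraisseAutomaton hU hage M).init_empty
    refine Eq.trans (R.ofConfig_classOf hU hage M
      ⟨(R.fraisseAutomaton hU hage M).init, (R.fraisseAutomaton hU hage M).initVal hage⟩)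
      (Eq.trans ?_ hs)
    congr 1
    refine Sigma.ext rfl (heq_of_eq ?_)
    ext a
    exact hempty.elim a
  · intro c
    obtain ⟨⟨q, η⟩, rfl⟩ := R.exists_classOf_eq hU hage M c
    rw [ofConfig_classOf]
    exact M.accept_equivariant _ _

end OrbitSystem

end Representation

/-! ### Syntactic automata -/

section Syntactic

variable {D : Type w} {G : Subgroup (Equiv.Perm D)} {A : Type w} [MulAction G A]

namespace DetAutomaton

variable {X : Type x} [MulAction G X]

theorem evalFrom_smul (M : DetAutomaton G A X) (π : G) (q : X) (l : List A) :
    M.toDFA.evalFrom (π • q) (l.map (π • ·)) = π • M.toDFA.evalFrom q l := by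
  induction l generalizing q with
  | nil => rfl
  | cons a l ih =>
    rw [List.map_cons, DFA.evalFrom_cons, DFA.evalFrom_cons, M.step_equivariant, ih]

theorem eval_smul (M : DetAutomaton G A X) (π : G) (l : List A) :
    M.toDFA.eval (l.map (π • ·)) = π • M.toDFA.eval l := by
  rw [DFA.eval, ← M.evalFrom_smul, M.start_equivariant]

theorem Recognizes.syntacticSetoid_of_eval_eq {M : DetAutomaton G A X} {W : GLanguage G A}
    (h : M.Recognizes W) {l l' : List A} (he : M.toDFA.eval l = M.toDFA.eval l') :
    W.syntacticSetoid l l' := by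
  intro k
  rw [← h, ← h, DFA.mem_accepts, DFA.mem_accepts, DFA.eval, DFA.evalFrom_of_append,
    DFA.evalFrom_of_append]
  change M.toDFA.evalFrom (M.toDFA.eval l) k ∈ _ ↔ M.toDFA.evalFrom (M.toDFA.eval l') k ∈ _
  rw [he]

/-- Choose a word for each orbit of the quotient. If two chosen words lead to states in one orbit,
some `π` makes them lead to the same state, so they are equivalent up to `π` and their orbits
coincide. -/
theorem Recognizes.orbitFinite_syntacticQuotient {M : DetAutomaton G A X} {W : GLanguage G A}
    (h : M.Recognizes W) (hX : OrbitFinite G X) : OrbitFinite G W.SyntacticQuotient := by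
  have : Finite (MulAction.orbitRel.Quotient G X) := hX
  let word : MulAction.orbitRel.Quotient G W.SyntacticQuotient → List A :=
    fun o => Quotient.out (s := W.syntacticSetoid) o.out
  refine Finite.of_injective (fun o =>
    (Quotient.mk _ (M.toDFA.eval (word o)) : MulAction.orbitRel.Quotient G X)) fun o o' he => ?_
  obtain ⟨π, hπ⟩ : ∃ π : G, π • M.toDFA.eval (word o') = M.toDFA.eval (word o) :=
    Quotient.exact he
  rw [← M.eval_smul] at hπ
  have hs := Quotient.sound (h.syntacticSetoid_of_eval_eq hπ)
  rw [← Quotient.out_eq o, ← Quotient.out_eq o']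
  refine Quotient.sound (s := MulAction.orbitRel _ _) ⟨π, ?_⟩
  have ho : Quotient.mk W.syntacticSetoid (word o) = o.out := Quotient.out_eq _
  have ho' : Quotient.mk W.syntacticSetoid (word o') = o'.out := Quotient.out_eq _
  rw [← ho, ← ho']
  exact hs

theorem Iso.evalFrom {Y : Type*} [MulAction G Y] {M : DetAutomaton G A X}
    {N : DetAutomaton G A Y} (e : M.Iso N) (q : X) (l : List A) :
    e.toFun (M.toDFA.evalFrom q l) = N.toDFA.evalFrom (e.toFun q) l := by
  induction l generalizing q with
  | nil => rfl
  | cons a l ih => rw [DFA.evalFrom_cons, DFA.evalFrom_cons, ih, e.map_step]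

theorem Iso.recognizes {Y : Type*} [MulAction G Y] {M : DetAutomaton G A X}
    {N : DetAutomaton G A Y} (e : M.Iso N) {W : GLanguage G A} (h : M.Recognizes W) :
    N.Recognizes W := by
  intro l
  rw [← h l, DFA.mem_accepts, DFA.mem_accepts, DFA.eval, DFA.eval, ← e.map_start,
    ← e.evalFrom]
  exact (e.map_accept _).symm

/-- The structure of a `G`-DFA can be transported along a bijection of its states. -/
theorem IsGDFA.exists_recognizes_of_equiv {Y : Type*} [MulAction G Y] {N : DetAutomaton G A Y}
    (hN : N.IsGDFA) {W : GLanguage G A} (hW : N.Recognizes W) {X' : Type x} (e : X' ≃ Y) :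
    ∃ (_ : MulAction G X') (M : DetAutomaton G A X'), M.IsGDFA ∧ M.Recognizes W := by
  let : MulAction G X' := e.mulAction G
  have he : ∀ (π : G) (q : X'), e (π • q) = π • e q := fun π q => e.apply_symm_apply _
  have he' : ∀ (π : G) (c : Y), e.symm (π • c) = π • e.symm c := fun π c =>
    e.injective (by rw [he, e.apply_symm_apply, e.apply_symm_apply])
  let M : DetAutomaton G A X' :=
    { step := fun q a => e.symm (N.step (e q) a)
      start := e.symm N.start
      accept := {q | e q ∈ N.accept}
      start_equivariant := fun π => by rw [← he', N.start_equivariant]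
      accept_equivariant := fun π q => by
        simp only [Set.mem_ofPred_eq, he, N.accept_equivariant]
      step_equivariant := fun π q a => by rw [he, N.step_equivariant, he'] }
  have i : N.Iso M :=
    { toEquiv := e.symm
      map_smul := he'
      map_start := rfl
      map_accept := fun c => (iff_of_eq (congrArg (· ∈ N.accept) (e.apply_symm_apply c))).symm
      map_step := fun c a => congrArg (fun c' => e.symm (N.step c' a))
        (e.apply_symm_apply c).symm }
  refine ⟨inferInstance, M, ⟨hN.alphabet_orbitFinite, hN.alphabet_nominal, ?_, ?_⟩,
    i.recognizes hW⟩
  · have : Finite (MulAction.orbitRel.Quotient G Y) := hN.states_orbitFinite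
    refine Finite.of_injective
      (fun o : MulAction.orbitRel.Quotient G X' =>
        (Quotient.mk _ (e o.out) : MulAction.orbitRel.Quotient G Y)) fun o o' h => ?_
    obtain ⟨π, hπ⟩ : ∃ π : G, π • e o'.out = e o.out := Quotient.exact h
    rw [← Quotient.out_eq o, ← Quotient.out_eq o']
    exact Quotient.sound (s := MulAction.orbitRel _ _) ⟨π, e.injective ((he _ _).trans hπ)⟩
  · intro q
    obtain ⟨C, hC, hs⟩ := hN.states_nominal (e q)
    exact ⟨C, hC, fun π hπ => e.injective ((he _ _).trans (hs π hπ))⟩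

/-- A `G`-DFA with countably many states has a copy in every universe. -/
theorem IsGDFA.exists_recognizes_of_countable {Y : Type*} [MulAction G Y] [Countable Y]
    {N : DetAutomaton G A Y} (hN : N.IsGDFA) {W : GLanguage G A} (hW : N.Recognizes W) :
    ∃ (X : Type x) (_ : MulAction G X) (M : DetAutomaton G A X),
      M.IsGDFA ∧ M.Recognizes W :=
  -- A countable type is equivalent to one in `Type`, which then lifts to any universe.
  ⟨_, hN.exists_recognizes_of_equiv hW (Equiv.ulift.trans (equivShrink.{0} Y).symm)⟩

end DetAutomaton

namespace GLanguage

variable (W : GLanguage G A)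

/-- The syntactic automaton, with states the syntactic quotient. -/
def syntacticAutomaton : DetAutomaton G A W.SyntacticQuotient where
  step c a := Quotient.map (sa := W.syntacticSetoid) (sb := W.syntacticSetoid) (· ++ [a])
    (fun l l' h k => by simpa only [List.append_assoc] using h ([a] ++ k)) c
  start := Quotient.mk W.syntacticSetoid []
  accept := {c | Quotient.liftOn (s := W.syntacticSetoid) c (· ∈ W.words) fun l l' h =>
    propext (by simpa using h [])}
  start_equivariant _ := rfl
  accept_equivariant := by
    rintro π ⟨l⟩
    exact W.equivariant π l
  step_equivariant := by
    rintro π ⟨l⟩ a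
    exact congrArg (Quotient.mk W.syntacticSetoid) (by simp)

theorem syntacticAutomaton_eval (l : List A) :
    W.syntacticAutomaton.toDFA.eval l = Quotient.mk W.syntacticSetoid l := by
  induction l using List.reverseRecOn with
  | nil => rfl
  | append_singleton l a ih =>
    rw [DFA.eval_append_singleton, ih]
    rfl

theorem syntacticAutomaton_recognizes : W.syntacticAutomaton.Recognizes W := by
  intro l
  rw [DFA.mem_accepts, W.syntacticAutomaton_eval]
  rfl

/-- The class of a word is supported by the union of supports of its letters. -/
theorem isNominal_syntacticQuotient (hA : IsNominal G A) : IsNominal G W.SyntacticQuotient := by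
  rintro ⟨l⟩
  choose C hC hs using hA
  refine ⟨⋃ a ∈ {a | a ∈ l}, C a, (List.finite_toSet l).biUnion fun a _ => hC a,
    fun π hπ => congrArg (Quotient.mk W.syntacticSetoid) ?_⟩
  refine (List.map_congr_left fun a ha => ?_).trans (List.map_id l)
  exact hs a π fun c hc => hπ c (Set.mem_biUnion (show a ∈ {a | a ∈ l} from ha) hc)

end GLanguage

end Syntactic

/-! ### Configurations of Fraïssé automata -/

namespace FraisseAutomaton

variable {L : FirstOrder.Language.{u, v}} [L.IsRelational]
  {K : Set (Bundled.{w} L.Structure)} (F : FraisseAutomaton K) {U : Type w} [L.Structure U]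

theorem finite_registers (hage : L.age U = K) (q : F.Q) : Finite (F.A q) :=
  Structure.FG.finite (show F.A q ∈ L.age U from hage ▸ F.A_mem q).1

/-- Configurations live in the universe of `U`; countability allows them to be moved to the universe
of the state sets. Finitely many registers with values in a countable set have countably many
valuations. -/
theorem countable_config [Countable U] (hage : L.age U = K) : Countable (F.Config U) := by
  have := F.finite_Q
  have h : ∀ q, Countable (RegValuation (F.S q) U) := fun q => by
    have := F.finite_registers hage q
    have : Countable (F.A q ↪[L] U) := DFunLike.coe_injective.countable
    exact inferInstanceAs (Countable (Quotient _))
  exact inferInstanceAs (Countable (Σ q, RegValuation (F.S q) U))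

theorem isNominal_config (hage : L.age U = K) : IsNominal (autGroup L U) (F.Config U) := by
  rintro ⟨q, ⟨η⟩⟩
  have := F.finite_registers hage q
  refine ⟨Set.range η, Set.finite_range η, fun π hπ => ?_⟩
  refine congrArg (fun p => (⟨q, RegValuation.mk (F.S q) p⟩ : F.Config U)) ?_
  ext a
  exact hπ _ ⟨a, rfl⟩

/-- By homogeneity any two valuations of the same registers are related by an automorphism, so the
control state determines the orbit. -/
theorem orbitFinite_config (hU : L.IsUltrahomogeneous U) (hage : L.age U = K) :
    OrbitFinite (autGroup L U) (F.Config U) := by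
  have := F.finite_Q
  refine Finite.of_injective
    (fun o : MulAction.orbitRel.Quotient (autGroup L U) (F.Config U) => o.out.1) fun o o' h => ?_
  rw [← Quotient.out_eq o, ← Quotient.out_eq o']
  refine Quotient.sound (s := MulAction.orbitRel _ _) ?_
  change o.out.1 = o'.out.1 at h
  generalize o.out = c at h ⊢
  generalize o'.out = c' at h ⊢
  obtain ⟨q, ⟨η⟩⟩ := c
  obtain ⟨q', ⟨θ⟩⟩ := c'
  obtain rfl : q = q' := h
  have := F.finite_registers hage q
  obtain ⟨π, hπ⟩ := exists_autGroup_smul_eq hU Structure.FG.of_finite θ η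
  refine ⟨π, congrArg (fun p => (⟨q, RegValuation.mk (F.S q) p⟩ : F.Config U)) ?_⟩
  ext a
  exact hπ a

end FraisseAutomaton

end NominalAutomata

theorem theorem11p2
    -- a finite relational signature
    (L : FirstOrder.Language.{u, v}) [L.IsRelational] [Finite (Σ n, L.Relations n)]
    -- a Fraïssé class `K` and its Fraïssé limit `U`
    (K : Set (CategoryTheory.Bundled.{w} L.Structure)) (hK : FirstOrder.Language.IsFraisse K)
    (U : Type w) [L.Structure U] [Countable U] (hU : FirstOrder.Language.IsFraisseLimit K U)
    -- the induced data symmetry is well-behaved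
    (hW : NominalAutomata.WellBehaved (NominalAutomata.autGroup L U)) :
    -- every reachable orbit finite deterministic nominal automaton over the alphabet `U` is
    -- isomorphic to (the automaton induced by) a Fraïssé automaton
    (∀ (X : Type x) [MulAction (NominalAutomata.autGroup L U) X]
        (M : NominalAutomata.DetAutomaton (NominalAutomata.autGroup L U) U X),
        M.IsGDFA → M.Reachable →
        ∃ F : NominalAutomata.FraisseAutomaton K, Nonempty (M.Iso (F.toDetAutomaton hU.age))) ∧
    -- the three characterizations of recognizable languages
    (∀ W : NominalAutomata.GLanguage (NominalAutomata.autGroup L U) U,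
      List.TFAE
        [∃ (X : Type x) (_ : MulAction (NominalAutomata.autGroup L U) X)
            (M : NominalAutomata.DetAutomaton (NominalAutomata.autGroup L U) U X),
            M.IsGDFA ∧ M.Recognizes W,
          ∃ F : NominalAutomata.FraisseAutomaton K, (F.toDetAutomaton hU.age).Recognizes W,
          NominalAutomata.OrbitFinite (NominalAutomata.autGroup L U) W.SyntacticQuotient]) := by
  refine ⟨fun X _ M hM _ => ?_, fun W => ?_⟩
  · obtain ⟨R⟩ := NominalAutomata.OrbitSystem.exists_of_leastSupports hW.leastSupports
      hM.states_nominal hM.states_orbitFinite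
    exact ⟨_, R.nonempty_iso hU.ultrahomogeneous hU.age M⟩
  · have hnom := NominalAutomata.isNominal_carrier (L := L) (U := U)
    have hfin := NominalAutomata.orbitFinite_carrier hU.ultrahomogeneous
    tfae_have 1 → 3 := by
      rintro ⟨X, _, M, hM, hMW⟩
      exact hMW.orbitFinite_syntacticQuotient hM.states_orbitFinite
    -- The syntactic automaton is nominal because its letters are, so orbit finiteness suffices to
    -- represent it.
    tfae_have 3 → 2 := by
      intro h
      obtain ⟨R⟩ := NominalAutomata.OrbitSystem.exists_of_leastSupports hW.leastSupports
        (W.isNominal_syntacticQuotient hnom) h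
      obtain ⟨i⟩ := R.nonempty_iso hU.ultrahomogeneous hU.age W.syntacticAutomaton
      exact ⟨_, i.recognizes W.syntacticAutomaton_recognizes⟩
    tfae_have 2 → 1 := by
      rintro ⟨F, hF⟩
      have := F.countable_config hU.age
      have hG : (F.toDetAutomaton hU.age).IsGDFA :=
        ⟨hfin, hnom, F.orbitFinite_config hU.ultrahomogeneous hU.age, F.isNominal_config hU.age⟩
      exact hG.exists_recognizes_of_countable hF
    tfae_finish
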